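/- Call a category elementary if there are a set-sized, one-sorted, finitary first-order signature $L$ and a first-order $L$-theory $T$ such that the category is equivalent to $\mathbf{Mod}(T)$, the category whose objects are the models of $T$ (the empty structure being admitted if it satisfies $T$) and whose morphisms are all $L$-homomorphisms, i.e. maps that commute with the function symbols and preserve, but need not reflect, the relation symbols. Let $\mathbf{KH}$ be the category of compact Hausdorff spaces and continuous maps, and let $\mathbf{CC^*Alg}$ be the category of commutative unital complex $C^*$-algebras and unit-preserving $*$-homomorphisms. Then $\mathbf{KH}^{\mathrm{op}}$ is not elementary. Moreover, $\mathbf{KH}^{\mathrm{op}}$ is equivalent to $\mathbf{CC^*Alg}$, and $\mathbf{CC^*Alg}$ is not elementary either. -/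

import Mathlib

open CategoryTheory

universe u v w

/-- An object of the category `Mod(T)`: a set carrying an `L`-structure that satisfies every
sentence of `T`. As is usual in category theory, an empty structure is admitted if it satisfies
`T`; a convention that excludes it is recovered by adding the sentence `∃ x, ⊤` to `T`. -/
structure ModelCat {L : FirstOrder.Language.{u, u}} (T : L.Theory) : Type (u + 1) where
  carrier : Type u
  [struc : L.Structure carrier]
  [isModel : carrier ⊨ T]

namespace ModelCat

attribute [instance] struc isModel

/-- The category `Mod(T)` of models of `T` and all homomorphisms, i.e. maps that commute with the
function symbols and preserve (but need not reflect) the relation symbols. -/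
instance {L : FirstOrder.Language.{u, u}} (T : L.Theory) : Category.{u} (ModelCat T) where
  Hom M N := L.Hom M.carrier N.carrier
  id M := FirstOrder.Language.Hom.id L M.carrier
  comp f g := FirstOrder.Language.Hom.comp g f

end ModelCat

/-- A category is elementary if it is equivalent to the category `Mod(T)` of some first-order
theory `T`. The universe `Type u` plays the role of the universe of sets: the signature and the
underlying sets of the models live in it. -/
def IsElementary (C : Type v) [Category.{w} C] : Prop :=
  ∃ (L : FirstOrder.Language.{u, u}) (T : L.Theory), Nonempty (C ≌ ModelCat T)

/-- A commutative unital C⋆-algebra over `ℂ` (the zero algebra is included). -/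
structure CCStarAlg : Type (u + 1) where
  carrier : Type u
  [str : CommCStarAlgebra carrier]

namespace CCStarAlg

attribute [instance] str

/-- The category of commutative unital C⋆-algebras and unit-preserving ⋆-homomorphisms. -/
instance : Category.{u} CCStarAlg.{u} where
  Hom A B := A.carrier →⋆ₐ[ℂ] B.carrier
  id A := StarAlgHom.id ℂ A.carrier
  comp f g := g.comp f

end CCStarAlg

/-! In `CompHaus` the Cantor space is the limit of the finite spaces of binary words, hence a
sequential colimit in the opposite category. In `Mod(T)` every element of a colimit of a sequence of
nonempty models comes from some stage (`exists_ι_app_eq`), by Łoś's theorem. An equivalence would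
thus give a faithful set-valued `G` whose elements over the Cantor space depend on finitely many
digits. Pulling back along a surjection from the Cantor space onto [0,1], the action of points on
`G([0,1])` becomes locally constant, hence constant, so `G` identifies the endpoints. Gelfand
duality transfers this to C⋆-algebras. -/

open Filter Limits Opposite

/-! ### Homomorphisms of ultraproducts -/

namespace FirstOrder.Language.Ultraproduct

open Structure

variable {L : FirstOrder.Language} {α : Type*} {M N : α → Type*} {U : Ultrafilter α}
  [∀ a, L.Structure (M a)] [∀ a, L.Structure (N a)]

theorem relMap_cast {n : ℕ} (r : L.Relations n) (x : Fin n → ∀ a, M a) :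
    (RelMap r fun i => (x i : (U : Filter α).Product M)) ↔
      ∀ᶠ a in U, RelMap r fun i => x i a := by
  apply relMap_quotient_mk'

theorem exists_eq_cast {n : ℕ} (x : Fin n → (U : Filter α).Product M) :
    ∃ y : Fin n → ∀ a, M a, x = fun i => (y i : (U : Filter α).Product M) :=
  ⟨fun i => Quotient.out (x i), funext fun i => (Quotient.out_eq (x i)).symm⟩

/-- A family of maps which are eventually compatible with each instance of the operations and
relations induces a homomorphism into the ultraproduct. -/
def homOfEventually {A : Type*} [L.Structure A] (h : ∀ a, A → M a)
    (hfun : ∀ {n : ℕ} (f : L.Functions n) (x : Fin n → A),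
      ∀ᶠ a in U, h a (funMap f x) = funMap f fun i => h a (x i))
    (hrel : ∀ {n : ℕ} (r : L.Relations n) (x : Fin n → A), RelMap r x →
      ∀ᶠ a in U, RelMap r fun i => h a (x i)) :
    A →[L] (U : Filter α).Product M where
  toFun x := ((fun a => h a x : ∀ a, M a) : (U : Filter α).Product M)
  map_fun' f x := by
    refine Eq.trans ?_ (funMap_cast (u := U) f fun i a => h a (x i)).symm
    exact Quotient.sound (hfun f x)
  map_rel' r x hx := (relMap_cast (U := U) r fun i a => h a (x i)).2 (hrel r x hx)

/-- A family of homomorphisms induces a homomorphism between ultraproducts. -/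
def mapHom (U : Ultrafilter α) (h : ∀ a, M a →[L] N a) :
    (U : Filter α).Product M →[L] (U : Filter α).Product N where
  toFun := Quotient.map (fun x a => h a (x a)) fun _ _ hxy =>
    Eventually.mono hxy fun a ha => congrArg (h a) ha
  map_fun' f x := by
    obtain ⟨y, rfl⟩ := exists_eq_cast x
    refine Eq.trans (congrArg _ (funMap_cast (u := U) f y)) <|
      Eq.trans ?_ (funMap_cast (u := U) f fun i a => h a (y i a)).symm
    exact Quotient.sound (Eventually.of_forall fun a => (h a).map_fun f fun i => y i a)
  map_rel' r x hx := by
    obtain ⟨y, rfl⟩ := exists_eq_cast x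
    exact (relMap_cast (U := U) r fun i a => h a (y i a)).2
      (((relMap_cast r y).1 hx).mono fun a ha => (h a).map_rel r _ ha)

end FirstOrder.Language.Ultraproduct

/-! ### Sequential colimits of models -/

namespace ModelCat

open FirstOrder.Language

variable {L : FirstOrder.Language.{u, u}} {T : L.Theory}

/-- The forgetful functor from models of a theory to sets. -/
def forgetToType (T : L.Theory) : ModelCat T ⥤ Type u where
  obj M := M.carrier
  map f := TypeCat.ofHom f.toFun

instance : (forgetToType T).Faithful where
  map_injective {M N} f g h := by
    apply FirstOrder.Language.Hom.ext
    intro x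
    exact ConcreteCategory.congr_hom h x

/-- The ultraproduct of nonempty models, as a model. -/
def ultraproduct {α : Type} (U : Ultrafilter α) (M : α → ModelCat T)
    [∀ a, Nonempty (M a).carrier] : ModelCat T where
  carrier := (U : Filter α).Product fun a => (M a).carrier
  isModel := ⟨fun φ hφ => (Ultraproduct.sentence_realize φ).2
    (Eventually.of_forall fun a => (M a).isModel.realize_of_mem φ hφ)⟩

/-- Colimits of sequences of nonempty models are covered by the members of the sequence. -/
theorem exists_ι_app_eq {F : ℕ ⥤ ModelCat T} [∀ n, Nonempty (F.obj n).carrier] {c : Cocone F}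
    (hc : IsColimit c) (x : c.pt.carrier) :
    ∃ n, ∃ y : (F.obj n).carrier, (forgetToType T).map (c.ι.app n) y = x := by
  classical
  let U : Ultrafilter ℕ := hyperfilter ℕ
  have hU (n : ℕ) : ∀ᶠ m in (U : Filter ℕ), n ≤ m :=
    (Nat.hyperfilter_le_atTop) (eventually_ge_atTop n)
  let P := ultraproduct U F.obj
  have : Nonempty c.pt.carrier := ⟨x⟩
  -- The junk value for `m < n` is harmless: `U` is nonprincipal and ignores finitely many indices.
  let t (n m : ℕ) (y : (F.obj n).carrier) : (F.obj m).carrier :=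
    if h : n ≤ m then (F.map (homOfLE h)).toFun y else Classical.arbitrary _
  have ht {n m : ℕ} (h : n ≤ m) (y : (F.obj n).carrier) :
      t n m y = (F.map (homOfLE h)).toFun y := dif_pos h
  let d (n : ℕ) : F.obj n ⟶ P := Ultraproduct.homOfEventually (U := U) (t n)
    (fun f y => (hU n).mono fun m h => by
      simp only [ht h]
      exact (F.map (homOfLE h)).map_fun' f y)
    (fun r y hy => (hU n).mono fun m h => by
      simp only [ht h]
      exact (F.map (homOfLE h)).map_rel' r y hy)
  let s : Cocone F :=
    { pt := P
      ι :=
        { app := d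
          naturality := fun n m f => by
            apply FirstOrder.Language.Hom.ext
            intro y
            refine Quotient.sound ((hU m).mono fun k h => ?_)
            have e : F.map (homOfLE ((leOfHom f).trans h)) = F.map f ≫ F.map (homOfLE h) := by
              rw [← F.map_comp]; rfl
            change t m k _ = t n k y
            rw [ht h, ht ((leOfHom f).trans h), e]
            rfl } }
  let Q := ultraproduct U fun _ : ℕ => c.pt
  let g : P ⟶ Q := Ultraproduct.mapHom U fun n => c.ι.app n
  let δ : c.pt ⟶ Q := Ultraproduct.homOfEventually (U := U) (fun _ y => y)
    (fun _ _ => Eventually.of_forall fun _ => rfl) (fun _ _ h => Eventually.of_forall fun _ => h)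
  -- Hence the diagonal class of `x` has a representative whose `n`-th term lies in the image of
  -- stage `n`; agreement at one index suffices.
  have key : hc.desc s ≫ g = δ := by
    refine hc.hom_ext fun n => ?_
    rw [← Category.assoc, hc.fac]
    apply FirstOrder.Language.Hom.ext
    intro y
    refine Quotient.sound ((hU n).mono fun m h => ?_)
    change (c.ι.app m).toFun (t n m y) = (c.ι.app n).toFun y
    rw [ht h, ← c.w (homOfLE h)]
    rfl
  obtain ⟨z, hz⟩ := Quotient.exists_rep ((hc.desc s).toFun x)
  have hx : g.toFun ((hc.desc s).toFun x) = δ.toFun x :=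
    congrArg (fun k : c.pt ⟶ Q => k.toFun x) key
  rw [← hz] at hx
  obtain ⟨n, hn⟩ := (Quotient.exact hx : ∀ᶠ n in (U : Filter ℕ), _).exists
  exact ⟨n, z n, hn⟩

end ModelCat

theorem IsElementary.of_equivalence {C : Type*} [Category* C] {D : Type*} [Category* D]
    (h : IsElementary.{u} C) (e : C ≌ D) : IsElementary.{u} D := by
  obtain ⟨L, T, ⟨F⟩⟩ := h
  exact ⟨L, T, ⟨e.symm.trans F⟩⟩

/-! ### The Cantor space and the unit interval -/

namespace CompHaus

/-- The space of binary words of length `n`. -/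
abbrev binaryWords (n : ℕ) : CompHaus.{u} :=
  CompHaus.of (ULift.{u} (Fin n → Bool))

/-- The Cantor space. -/
abbrev cantorSpace : CompHaus.{u} :=
  CompHaus.of (ULift.{u} (ℕ → Bool))

/-- The inverse sequence of spaces of binary words under truncation. -/
def binarySequence : ℕ ⥤ CompHaus.{u}ᵒᵖ where
  obj n := op (binaryWords n)
  map {n m} f := (CompHausLike.ofHom _
    ⟨fun x : ULift.{u} (Fin m → Bool) => ULift.up fun i : Fin n => x.down (i.castLE (leOfHom f)),
      by fun_prop⟩ : binaryWords m ⟶ binaryWords n).op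

/-- The truncation from the Cantor space to binary words of length `n`. -/
def truncate (n : ℕ) : cantorSpace.{u} ⟶ binaryWords n :=
  CompHausLike.ofHom _ ⟨fun x => ULift.up fun i => x.down i, by fun_prop⟩

/-- The Cantor space as a cone over the spaces of binary words. -/
def binaryCocone : Cocone binarySequence.{u} where
  pt := op cantorSpace
  ι := { app := fun n => (truncate n).op }

/-- The Cantor space is the limit of the spaces of binary words. -/
def binaryCoconeIsColimit : IsColimit binaryCocone.{u} where
  desc s := Quiver.Hom.op (X := unop s.pt) (Y := cantorSpace) <| ConcreteCategory.ofHom (C := CompHaus)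
    ⟨fun y : (unop s.pt : CompHaus.{u}) => ULift.up fun i =>
        ((s.ι.app (i + 1)).unop : unop s.pt ⟶ binaryWords (i + 1)) y |>.down (Fin.last i), by
      refine continuous_uliftUp.comp (continuous_pi fun i => ?_)
      exact (continuous_apply (Fin.last i)).comp
        (continuous_uliftDown.comp ((s.ι.app (i + 1)).unop.hom.hom.continuous))⟩
  fac s n := by
    apply Quiver.Hom.unop_inj
    ext y
    refine ULift.down_injective (funext fun i => ?_)
    have h := s.w (homOfLE (Nat.succ_le_of_lt i.2))
    exact congrFun (congrArg ULift.down
      (ConcreteCategory.congr_hom (congrArg Quiver.Hom.unop h) y)).symm (Fin.last i)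
  uniq s m hm := by
    apply Quiver.Hom.unop_inj
    ext y
    refine ULift.down_injective (funext fun i => ?_)
    exact congrFun (congrArg ULift.down
      (ConcreteCategory.congr_hom (congrArg Quiver.Hom.unop (hm (i + 1))) y)) (Fin.last i)

/-- The unit interval, as a compact Hausdorff space in an arbitrary universe. -/
abbrev interval : CompHaus.{u} :=
  CompHaus.of (ULift.{u} unitInterval)

/-- A point of a space, as a map from the one-point space. -/
abbrev point (X : CompHaus.{u}) (x : X) : CompHaus.of PUnit.{u + 1} ⟶ X :=
  CompHausLike.const _ x

section Faithful

variable (G : CompHaus.{u}ᵒᵖ ⥤ Type u)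

/-- An empty value at the two-point space would identify its identity with a constant map; every
space has a constant map to it. -/
theorem nonempty_obj_of_faithful [G.Faithful] (X : CompHaus.{u}ᵒᵖ) : Nonempty (G.obj X) := by
  have h : Nonempty (G.obj (op (binaryWords 1))) := by
    by_contra h
    rw [not_nonempty_iff] at h
    have e : (CompHausLike.const (binaryWords.{u} 1) (⟨fun _ => false⟩ : binaryWords 1)).op =
        (𝟙 (binaryWords 1)).op := G.map_injective (by ext x; exact h.elim x)
    have := congrArg (fun x : binaryWords.{u} 1 => x.down 0)
      (ConcreteCategory.congr_hom (congrArg Quiver.Hom.unop e) ⟨fun _ => true⟩)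
    exact Bool.false_ne_true this
  exact h.map (G.map (CompHausLike.const X.unop (⟨fun _ => false⟩ : binaryWords 1)).op)

/-- If each element over the Cantor space comes from a space of binary words, then the action
of the points of the unit interval is constant. -/
theorem map_point_interval_eq
    (hG : ∀ x : G.obj (op cantorSpace), ∃ (n : ℕ) (y : G.obj (op (binaryWords n))),
      G.map (truncate n).op y = x) (x : G.obj (op interval)) (a b : unitInterval) :
    G.map (point interval ⟨a⟩).op x = G.map (point interval ⟨b⟩).op x := by
  obtain ⟨q, hqc, hqs⟩ := exists_nat_bool_continuous_surjective_of_compact unitInterval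
  let Q : cantorSpace.{u} ⟶ interval := CompHausLike.ofHom _ ⟨fun t => ⟨q t.down⟩, by fun_prop⟩
  obtain ⟨n, y, hy⟩ := hG (G.map Q.op x)
  let ψ (w : Fin n → Bool) := G.map (point (binaryWords n) ⟨w⟩).op y
  have hψ (t : ℕ → Bool) :
      G.map (point interval ⟨q t⟩).op x = ψ fun i => t i := by
    have e₁ : point interval ⟨q t⟩ = point cantorSpace ⟨t⟩ ≫ Q := rfl
    have e₂ : point (binaryWords n) ⟨fun i => t i⟩ = point cantorSpace ⟨t⟩ ≫ truncate n := rfl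
    simp only [ψ]
    rw [e₁, e₂, op_comp, op_comp, G.map_comp, G.map_comp]
    exact (congrArg (G.map (point cantorSpace ⟨t⟩).op) hy).symm
  have hlc : IsLocallyConstant fun a : unitInterval => G.map (point interval ⟨a⟩).op x := by
    intro s
    -- Openness can be tested on the Cantor space, where only the first `n` digits matter.
    rw [← (Topology.IsQuotientMap.of_surjective_continuous hqs hqc).isOpen_preimage]
    have : q ⁻¹' ((fun a : unitInterval => G.map (point interval ⟨a⟩).op x) ⁻¹' s) =
        (fun (t : ℕ → Bool) (i : Fin n) => t i) ⁻¹' (ψ ⁻¹' s) := by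
      ext t
      simp only [Set.mem_preimage, hψ]
    rw [this]
    exact (isOpen_discrete _).preimage (by fun_prop)
  exact hlc.apply_eq_of_preconnectedSpace a b

/-- No faithful functor from the opposite of compact Hausdorff spaces to sets sends the Cantor
space to the union of the images of the spaces of binary words. -/
theorem exists_forall_map_truncate_ne [G.Faithful] :
    ∃ x : G.obj (op cantorSpace), ∀ (n : ℕ) (y : G.obj (op (binaryWords n))),
      G.map (truncate n).op y ≠ x := by
  by_contra! hG
  have e : (point interval.{u} ⟨0⟩).op = (point interval ⟨1⟩).op :=
    G.map_injective (by ext x; exact map_point_interval_eq G hG x 0 1)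
  have := congrArg ULift.down
    (ConcreteCategory.congr_hom (congrArg Quiver.Hom.unop e) PUnit.unit)
  exact zero_ne_one (α := unitInterval) this

end Faithful

theorem not_isElementary_op : ¬ IsElementary.{u} CompHaus.{u}ᵒᵖ := by
  rintro ⟨L, T, ⟨F⟩⟩
  let G : CompHaus.{u}ᵒᵖ ⥤ Type u := F.functor ⋙ ModelCat.forgetToType T
  obtain ⟨x, hx⟩ := exists_forall_map_truncate_ne G
  have (n : ℕ) : Nonempty ((binarySequence ⋙ F.functor).obj n).carrier :=
    nonempty_obj_of_faithful G (op (binaryWords n))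
  obtain ⟨n, y, hy⟩ := ModelCat.exists_ι_app_eq
    (isColimitOfPreserves F.functor binaryCoconeIsColimit) x
  exact hx n y hy

end CompHaus

/-! ### Gelfand duality -/

namespace CCStarAlg

open WeakDual CharacterSpace

/-- The functor sending a compact Hausdorff space to its algebra of continuous functions. -/
noncomputable def continuousFunctions : CompHaus.{u}ᵒᵖ ⥤ CCStarAlg.{u} where
  obj X := { carrier := C(X.unop, ℂ) }
  map f := ContinuousMap.compStarAlgHom' ℂ ℂ f.unop.hom.hom

/-- The functor sending a commutative C⋆-algebra to its character space. -/
noncomputable def characters : CCStarAlg.{u} ⥤ CompHaus.{u}ᵒᵖ where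
  obj A := op (CompHaus.of (characterSpace ℂ A.carrier))
  map {A B} f := Quiver.Hom.op (X := CompHaus.of (characterSpace ℂ B.carrier))
    (Y := CompHaus.of (characterSpace ℂ A.carrier)) (CompHausLike.ofHom _ (compContinuousMap f))

/-- A star algebra isomorphism is an isomorphism of commutative C⋆-algebras. -/
def isoOfStarAlgEquiv {A B : CCStarAlg.{u}} (e : A.carrier ≃⋆ₐ[ℂ] B.carrier) : A ≅ B where
  hom := (e : A.carrier →⋆ₐ[ℂ] B.carrier)
  inv := (e.symm : B.carrier →⋆ₐ[ℂ] A.carrier)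
  hom_inv_id := StarAlgHom.ext e.symm_apply_apply
  inv_hom_id := StarAlgHom.ext e.apply_symm_apply

/-- Gelfand duality. -/
noncomputable def gelfandDuality : CompHaus.{u}ᵒᵖ ≌ CCStarAlg.{u} :=
  CategoryTheory.Equivalence.mk continuousFunctions characters
    (NatIso.ofComponents (F := continuousFunctions ⋙ characters) (G := 𝟭 _)
      (fun X => (CompHausLike.isoOfHomeo (X := X.unop)
        (Y := (characters.obj (continuousFunctions.obj X)).unop) (homeoEval X.unop ℂ)).op)
      fun _ => rfl).symm
    (NatIso.ofComponents (F := 𝟭 _) (G := characters ⋙ continuousFunctions)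
      (fun A => isoOfStarAlgEquiv (B := { carrier := C(characterSpace ℂ A.carrier, ℂ) })
        (gelfandStarTransform A.carrier))
      fun _ => rfl).symm

end CCStarAlg

theorem corollary3p3 :
    ¬ IsElementary.{u} CompHaus.{u}ᵒᵖ ∧
      Nonempty (CompHaus.{u}ᵒᵖ ≌ CCStarAlg.{u}) ∧
      ¬ IsElementary.{u} CCStarAlg.{u} :=
  ⟨CompHaus.not_isElementary_op, ⟨CCStarAlg.gelfandDuality⟩, fun h =>
    CompHaus.not_isElementary_op (h.of_equivalence CCStarAlg.gelfandDuality.symm)⟩
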